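/- Let $d\ge 1$, let $\bar{\mathcal X}\subset\mathbb R^d$ be a bounded convex set and let $f:\bar{\mathcal X}\to[0,1]$ be convex and measurable, extended by $+\infty$ outside $\bar{\mathcal X}$. Let $\mathcal X\subset\bar{\mathcal X}$ be convex with non-zero volume, and let $\mu_{\mathcal X}$ and $\Sigma_{\mathcal X}$ be the mean and the covariance matrix of the uniform distribution on $\mathcal X$. Put $$F(x)=\tfrac1{\sqrt d}\,\Sigma_{\mathcal X}^{-1/2}(x-\mu_{\mathcal X}),\qquad F^{-1}(z)=\sqrt d\,\Sigma_{\mathcal X}^{1/2}z+\mu_{\mathcal X},\qquad \bar{\mathcal Z}=F(\bar{\mathcal X}),\qquad g=f\circ F^{-1}.$$ For $c>0$ let $g_c(z)=\mathbb E\,g(z+Z)$ with $Z$ uniform on the closed Euclidean ball $\mathbb B_2(0,c)$, and let $g_0=g$. Let $c\ge 0$, let $z$ be such that $\mathbb B_2(z,c)\subset\bar{\mathcal Z}$, let $u\in\mathbb R^d$, $\delta>0$ and $N\ge 1$. Let $Z^{(b)}_1,\dots,Z^{(b)}_N$ be i.i.d. uniform on the ball $\mathbb B_2(0,c)$ and $Z^{(s)}_1,\dots,Z^{(s)}_N$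 i.i.d. uniform on the sphere of center $0$ and radius $c$ (both are the point mass at $0$ if $c=0$). For $k\in\{b,s\}$ let $\tilde y^{(k)}_1,\dots,\tilde y^{(k)}_N\in[0,1]$ be noisy observations of $f$ at the points $F^{-1}(z+Z_i^{(k)})$, that is, $\mathbb E[\tilde y_i^{(k)}\mid F^{-1}(z+Z_i^{(k)})=x]=f(x)$, and the pairs $(Z_i^{(k)},\tilde y_i^{(k)})_{i\le N}$ are independent. Define $$\hat g_c(z)=\frac1N\sum_{i=1}^N\tilde y_i^{(b)},\qquad \widehat{\nabla g_c}(z)=\frac{d}{c^2N}\sum_{i=1}^N Z_i^{(s)}\tilde y_i^{(s)}\quad(c>0),\qquad \eta_{\mathrm{conc}}(1/\delta)=4\sqrt{\log(2/\delta)},$$ where $\log(2/\delta)$ is replaced by $0$ in $\eta_{\mathrm{conc}}$ if $\delta>2$. If $c>0$ and $\mathbb B_2(z,c)$ is contained in the interior of $\bar{\mathcal Z}$, then $g_c$ is differentiable at $z$. Moreover, with probability at least $1-\delta$, the following hold simultaneously: 1. $\displaystyle |\hat g_c(z)-g_c(z)|\le \frac{\eta_{\mathrm{conc}}(1/\delta)}{\sqrt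 N}$; 2. if $c>0$ and $N\ge d\log(2/\delta)$, then $$|\langle\widehat{\nabla g_c}(z)-G,u\rangle|\le \eta_{\mathrm{conc}}(1/\delta)\,\|u\|_2\,\frac{\sqrt d}{c\sqrt N}$$ for $G=\frac{d}{c^2}\,\mathbb E[Z\,g(z+Z)]$ with $Z$ uniform on the sphere of center $0$ and radius $c$, and also for $G=\nabla g_c(z)$ whenever $\mathbb B_2(z,c)$ is contained in the interior of $\bar{\mathcal Z}$. -/

import Mathlib

open MeasureTheory ProbabilityTheory Set Metric
open scoped RealInnerProductSpace Gradient MatrixOrder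

noncomputable section

namespace ZerothOrder

/-- `ℝ^d` with the Euclidean norm and inner product. -/
abbrev Vec (d : ℕ) : Type := EuclideanSpace ℝ (Fin d)

/-! ### Isotropic normalisation of a convex set -/

/-- The uniform distribution on a set of finite non-zero volume. -/
def unif {d : ℕ} (X : Set (Vec d)) : Measure (Vec d) :=
  ProbabilityTheory.cond volume X

/-- The barycenter `μ_X` of `X`. -/
def barycenter {d : ℕ} (X : Set (Vec d)) : Vec d :=
  ∫ x, x ∂(unif X)

/-- The variance-covariance matrix `Σ_X` of the uniform distribution on `X`. -/
def covMatrix {d : ℕ} (X : Set (Vec d)) : Matrix (Fin d) (Fin d) ℝ :=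
  Matrix.of fun i j => covariance (fun x : Vec d => x i) (fun x : Vec d => x j) (unif X)

/-- The symmetric positive semidefinite square root `Σ_X^{1/2}`. -/
def sqrtCov {d : ℕ} (X : Set (Vec d)) : Matrix (Fin d) (Fin d) ℝ :=
  CFC.sqrt (covMatrix X)

/-- The normalisation `F_X(x) = d^{-1/2} Σ_X^{-1/2} (x - μ_X)`. -/
def normMap {d : ℕ} (X : Set (Vec d)) (x : Vec d) : Vec d :=
  (1 / √(d : ℝ)) • Matrix.toEuclideanLin (sqrtCov X)⁻¹ (x - barycenter X)

/-- The inverse normalisation `F_X⁻¹(z) = d^{1/2} Σ_X^{1/2} z + μ_X`. -/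
def normInv {d : ℕ} (X : Set (Vec d)) (z : Vec d) : Vec d :=
  √(d : ℝ) • Matrix.toEuclideanLin (sqrtCov X) z + barycenter X

/-- The normalised objective `g^X = f ∘ F_X⁻¹`. -/
def gFun {d : ℕ} (f : Vec d → ℝ) (X : Set (Vec d)) (z : Vec d) : ℝ :=
  f (normInv X z)

/-! ### Uniform laws on balls and spheres, and smoothing -/

/-- The uniform law on the closed Euclidean ball of center `0` and radius `c ≥ 0`
(the point mass at `0` when `c = 0`). -/
def ballUnif (d : ℕ) (c : ℝ) : Measure (Vec d) :=
  if c = 0 then Measure.dirac 0 else unif (closedBall (0 : Vec d) c)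

/-- The uniform law on the Euclidean sphere of center `0` and radius `c ≥ 0`: the normalised
surface measure of the unit sphere, pushed forward by scaling with `c`. -/
def sphereUnif (d : ℕ) (c : ℝ) : Measure (Vec d) :=
  Measure.map (fun w : sphere (0 : Vec d) 1 => c • (w : Vec d))
    (ProbabilityTheory.cond (volume : Measure (Vec d)).toSphere univ)

/-- The smoothed function `g_c(z) = E_{Z ∼ U(B(c))} g(z + Z)`; in particular `g_0 = g`. -/
def smooth {d : ℕ} (g : Vec d → ℝ) (c : ℝ) (z : Vec d) : ℝ :=
  ∫ w, g (z + w) ∂(ballUnif d c)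

/-- The spherical mean `(d / c²) E_{Z ∼ U(S(c))} [g(z + Z) Z]`. -/
def sphereMean {d : ℕ} (g : Vec d → ℝ) (c : ℝ) (z : Vec d) : Vec d :=
  ((d : ℝ) / c ^ 2) • ∫ w, g (z + w) • w ∂(sphereUnif d c)

/-! ### Noisy observations and estimators -/

/-- `Y 0, …, Y (N-1)` are independent noisy observations, with values in `[0,1]`, of the function
`f` at the points `q (Z 0), …, q (Z (N-1))`, where the `Z i` are i.i.d. with law `ν`. The noise
does not have to be identically distributed. -/
structure IsNoisySample {Ω : Type*} [MeasurableSpace Ω] (P : Measure Ω) {d N : ℕ}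
    (ν : Measure (Vec d)) (f : Vec d → ℝ) (q : Vec d → Vec d)
    (Z : Fin N → Ω → Vec d) (Y : Fin N → Ω → ℝ) : Prop where
  measurable_Z : ∀ i, Measurable (Z i)
  measurable_Y : ∀ i, Measurable (Y i)
  law_Z : ∀ i, Measure.map (Z i) P = ν
  mem_Icc : ∀ i, ∀ᵐ ω ∂P, Y i ω ∈ Icc (0 : ℝ) 1
  /-- `E[Y i | q (Z i) = x] = f x`. -/
  condExp_eq : ∀ i,
    P[Y i | MeasurableSpace.comap (fun ω => q (Z i ω)) inferInstance] =ᵐ[P]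
      fun ω => f (q (Z i ω))
  /-- Sampling is not adaptive, and each observation is, given its sampling point, independent
  of the other rounds: the pairs (perturbation, observation) are independent. -/
  indep : iIndepFun (fun i ω => (Z i ω, Y i ω)) P

/-- The estimator `ĝ_c(z) = (1/N) ∑ Y_i`. -/
def valueEst {N : ℕ} (y : Fin N → ℝ) : ℝ :=
  (1 / (N : ℝ)) * ∑ i, y i

/-- The estimator of the gradient, `(d / (c² N)) ∑ Y_i Z_i`. -/
def gradEst {d N : ℕ} (c : ℝ) (w : Fin N → Vec d) (y : Fin N → ℝ) : Vec d :=
  ((d : ℝ) / (c ^ 2 * (N : ℝ))) • ∑ i, y i • w i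

/-- `η_conc(t) = 4 √(log (2 t))`, so that `η_conc(1/δ) = 4 √(log (2/δ))`. -/
def etaConc (t : ℝ) : ℝ :=
  4 * √(Real.log (2 * t))

end ZerothOrder

end

/-! Since `X` is bounded and convex with non-zero volume, its covariance is positive definite, so
`normMap` and `normInv` are mutually inverse affine maps and `g` is convex, hence continuous, in the
interior of the normalised domain.

Differentiability and the formula ∇g_c = (d/c²) E[Z g(z+Z)] are a divergence theorem for a merely
continuous `g`. The indicator of the ball of radius `c` is the limit, as b decreases to c, of the
Lipschitz kernels ((b² - s²)⁺ - (c² - s²)⁺)/(b² - c²), where s is the distance to the centre.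
Against such a kernel the integral of `g` can be differentiated under the integral sign. Its
derivative is an average of fluxes over the shell between c and b, and converges locally uniformly
to the flux through the sphere of radius `c` (`hasFDerivAt_setIntegral_closedBall`,
`hasGradientAt_smooth`).

Both estimators are averages of independent variables with the right mean, by conditioning on the
sampling point (`integral_mul`). A Bernstein bound for variables in [-1,1] with second moment at
most s (`measureReal_abs_sum_sub_ge_le`) is used with s = 1 for the value. For the gradient it is
used with s = 1/d, because a unit vector paired with a uniform point of the unit sphere has second
moment 1/d; this gives √d in place of d. A union bound joins the two events, so no relation between
the ball and sphere samples matters. -/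

namespace ZerothOrder

/-! ### Invertibility of the isotropic normalisation. -/

section Normalisation

variable {d : ℕ} {X : Set (Vec d)}

lemma isProbabilityMeasure_unif (h0 : volume X ≠ 0) (hX : Bornology.IsBounded X) :
    IsProbabilityMeasure (unif X) :=
  cond_isProbabilityMeasure_of_finite h0 hX.measure_lt_top.ne

lemma memLp_inner_unif (h0 : volume X ≠ 0) (hX : Bornology.IsBounded X) (hconv : Convex ℝ X)
    (v : Vec d) : MemLp (fun x : Vec d => ⟪v, x⟫) 2 (unif X) := by
  have := isProbabilityMeasure_unif h0 hX
  obtain ⟨R, hR⟩ := hX.exists_norm_le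
  refine MemLp.of_bound (by fun_prop) (‖v‖ * R) ?_
  refine Measure.ae_smul_measure ?_ _
  -- `X` need not be Borel; convexity makes it null measurable, which suffices.
  filter_upwards [ae_restrict_mem₀ (hconv.nullMeasurableSet volume)] with x hx
  exact (norm_inner_le_norm v x).trans (by gcongr; exact hR x hx)

/-- With zero variance, almost all of `X` would lie in one hyperplane orthogonal to `v`, which is a
null set. -/
lemma variance_inner_unif_pos (h0 : volume X ≠ 0) (hX : Bornology.IsBounded X)
    (hconv : Convex ℝ X) {v : Vec d} (hv : v ≠ 0) :
    0 < Var[fun x : Vec d => ⟪v, x⟫; unif X] := by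
  have := isProbabilityMeasure_unif h0 hX
  refine lt_of_le_of_ne (variance_nonneg _ _) fun h => h0 ?_
  have hae := ae_eq_integral_of_variance_eq_zero (memLp_inner_unif h0 hX hconv v) h.symm
  set a : ℝ := ∫ x : Vec d, ⟪v, x⟫ ∂(unif X)
  let A : AffineSubspace ℝ (Vec d) :=
    (AffineSubspace.mk' a ⊥).comap (innerₛₗ ℝ v).toAffineMap
  have hA : ∀ x, x ∈ A ↔ ⟪v, x⟫ = a := fun x => by
    simp [A, AffineSubspace.mem_comap, AffineSubspace.mem_mk', sub_eq_zero]
  have hAtop : A ≠ ⊤ := fun htop => hv <| by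
    have h1 : ⟪v, (0 : Vec d)⟫ = a := (hA 0).1 (htop ▸ AffineSubspace.mem_top ℝ _ _)
    have h2 : ⟪v, v⟫ = a := (hA v).1 (htop ▸ AffineSubspace.mem_top ℝ _ _)
    rw [inner_zero_right] at h1
    exact inner_self_eq_zero.1 (h2.trans h1.symm)
  have hnull := Measure.addHaar_affineSubspace volume A hAtop
  have hres : ∀ᵐ x ∂(volume.restrict X), ⟪v, x⟫ = a := by
    rw [unif, ProbabilityTheory.cond] at hae
    exact (Measure.ae_ennreal_smul_measure_iff
      (ENNReal.inv_ne_zero.2 hX.measure_lt_top.ne)).1 hae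
  have hres' := ae_imp_of_ae_restrict hres
  refine measure_mono_null (t := (A : Set (Vec d)) ∪ {x | ¬(x ∈ X → ⟪v, x⟫ = a)}) ?_
    (measure_union_null hnull hres')
  intro x hx
  by_cases hxa : ⟪v, x⟫ = a
  · exact Or.inl ((hA x).2 hxa)
  · exact Or.inr fun hx' => hxa (hx' hx)

lemma dotProduct_covMatrix_mulVec (h0 : volume X ≠ 0) (hX : Bornology.IsBounded X)
    (hconv : Convex ℝ X) (v : Fin d → ℝ) :
    v ⬝ᵥ (covMatrix X).mulVec v
      = Var[fun x : Vec d => ⟪(WithLp.toLp 2 v : Vec d), x⟫; unif X] := by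
  have := isProbabilityMeasure_unif h0 hX
  have hcoord : ∀ i, MemLp (fun x : Vec d => x i) 2 (unif X) := fun i => by
    simpa [EuclideanSpace.inner_single_left] using
      memLp_inner_unif h0 hX hconv (EuclideanSpace.single i (1 : ℝ))
  have hsum : (fun x : Vec d => ⟪(WithLp.toLp 2 v : Vec d), x⟫) = fun x => ∑ i, v i * x i := by
    funext x
    simp [PiLp.inner_apply, mul_comm]
  rw [hsum, ← covariance_self (by fun_prop), covariance_fun_sum_fun_sum
    (fun i => (hcoord i).const_mul _) (fun i => (hcoord i).const_mul _)]
  simp only [covariance_const_mul_left, covariance_const_mul_right, dotProduct, Matrix.mulVec,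
    covMatrix, Matrix.of_apply, Finset.mul_sum]
  refine Finset.sum_congr rfl fun i _ => Finset.sum_congr rfl fun j _ => by ring

lemma posDef_covMatrix (h0 : volume X ≠ 0) (hX : Bornology.IsBounded X) (hconv : Convex ℝ X) :
    (covMatrix X).PosDef := by
  refine Matrix.PosDef.of_dotProduct_mulVec_pos ?_ fun v hv => ?_
  · ext i j
    simp [covMatrix, covariance_comm]
  · rw [star_trivial, dotProduct_covMatrix_mulVec h0 hX hconv]
    exact variance_inner_unif_pos h0 hX hconv fun h => hv (by simpa using h)

lemma isUnit_det_sqrtCov (h0 : volume X ≠ 0) (hX : Bornology.IsBounded X)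
    (hconv : Convex ℝ X) : IsUnit (sqrtCov X).det := by
  have h := posDef_covMatrix h0 hX hconv
  rw [← Matrix.isUnit_iff_isUnit_det]
  exact (CFC.isUnit_sqrt_iff _ h.posSemidef.nonneg).2 h.isUnit

lemma normInv_normMap (hd : 1 ≤ d) (h : IsUnit (sqrtCov X).det) (x : Vec d) :
    normInv X (normMap X x) = x := by
  have hd' : √(d : ℝ) ≠ 0 := by positivity
  rw [normInv, normMap, map_smul, smul_smul, mul_one_div_cancel hd', one_smul,
    ← LinearMap.comp_apply, ← Matrix.toLpLin_mul_same, Matrix.mul_nonsing_inv _ h]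
  simp

lemma normMap_normInv (hd : 1 ≤ d) (h : IsUnit (sqrtCov X).det) (z : Vec d) :
    normMap X (normInv X z) = z := by
  have hd' : √(d : ℝ) ≠ 0 := by positivity
  rw [normInv, normMap, add_sub_cancel_right, map_smul, smul_smul, one_div_mul_cancel hd',
    one_smul, ← LinearMap.comp_apply, ← Matrix.toLpLin_mul_same, Matrix.nonsing_inv_mul _ h]
  simp

lemma continuous_normInv : Continuous (normInv X) := by
  unfold normInv
  have := LinearMap.continuous_of_finiteDimensional (Matrix.toEuclideanLin (sqrtCov X))
  fun_prop

lemma continuous_normMap : Continuous (normMap X) := by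
  unfold normMap
  have := LinearMap.continuous_of_finiteDimensional (Matrix.toEuclideanLin (sqrtCov X)⁻¹)
  fun_prop

lemma normMap_image_eq_preimage (hd : 1 ≤ d) (h : IsUnit (sqrtCov X).det) (s : Set (Vec d)) :
    normMap X '' s = normInv X ⁻¹' s :=
  congrFun (image_eq_preimage_of_inverse (normInv_normMap hd h) (normMap_normInv hd h)) s

lemma convexOn_gFun {s : Set (Vec d)} {f : Vec d → ℝ} (hf : ConvexOn ℝ s f) :
    ConvexOn ℝ (normInv X ⁻¹' s) (gFun f X) := by
  let A : Vec d →ᵃ[ℝ] Vec d :=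
    (√(d : ℝ) • Matrix.toEuclideanLin (sqrtCov X)).toAffineMap + AffineMap.const ℝ _ (barycenter X)
  have hA : (A : Vec d → Vec d) = normInv X := by
    funext z
    simp [A, normInv]
  have := hf.comp_affineMap A
  rwa [hA] at this

end Normalisation

/-! ### A Bernstein inequality. -/

section Concentration

variable {Ω : Type*} [MeasurableSpace Ω] {P : Measure Ω} [IsProbabilityMeasure P]

/-- Integrate exp x ≤ 1 + x + x², valid for |x| ≤ 1, at x = tW, then apply 1 + y ≤ exp y. Keeping
the second moment, rather than bounding it by 1, is what later yields the factor √d. -/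
lemma mgf_le_of_abs_le_one {W : Ω → ℝ} (hW : AEMeasurable W P) (hb : ∀ᵐ ω ∂P, |W ω| ≤ 1)
    {s : ℝ} (hs : ∫ ω, W ω ^ 2 ∂P ≤ s) {t : ℝ} (ht : |t| ≤ 1) :
    mgf W P t ≤ Real.exp (t * ∫ ω, W ω ∂P + t ^ 2 * s) := by
  have hint : Integrable W P := Integrable.of_bound hW.aestronglyMeasurable 1 hb
  have hint2 : Integrable (fun ω => W ω ^ 2) P := by
    refine Integrable.of_bound (by fun_prop) 1 ?_
    filter_upwards [hb] with ω h
    rw [Real.norm_eq_abs, abs_pow]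
    exact pow_le_one₀ (abs_nonneg _) h
  have hle : mgf W P t ≤ ∫ ω, (1 + t * W ω + t ^ 2 * W ω ^ 2) ∂P := by
    refine integral_mono_of_nonneg (ae_of_all _ fun ω => (Real.exp_pos _).le)
      (((integrable_const _).add (hint.const_mul t)).add (hint2.const_mul _)) ?_
    filter_upwards [hb] with ω h
    have h1 : |t * W ω| ≤ 1 := by
      rw [abs_mul]
      exact mul_le_one₀ ht (abs_nonneg _) h
    have h2 := (abs_le.1 (Real.abs_exp_sub_one_sub_id_le h1)).2
    rw [mul_pow] at h2
    linarith
  have heq : ∫ ω, (1 + t * W ω + t ^ 2 * W ω ^ 2) ∂P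
      = t * ∫ ω, W ω ∂P + t ^ 2 * ∫ ω, W ω ^ 2 ∂P + 1 := by
    have h1 : Integrable (fun ω => 1 + t * W ω) P := (integrable_const _).add (hint.const_mul t)
    rw [integral_add h1 (hint2.const_mul _), integral_add (integrable_const _) (hint.const_mul t),
      integral_const_mul, integral_const_mul]
    simp
    ring
  calc mgf W P t ≤ t * ∫ ω, W ω ∂P + t ^ 2 * ∫ ω, W ω ^ 2 ∂P + 1 := hle.trans heq.le
    _ ≤ t * ∫ ω, W ω ∂P + t ^ 2 * s + 1 := by gcongr
    _ ≤ _ := Real.add_one_le_exp _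

/-- One-sided Bernstein inequality in the sub-Gaussian range of deviations. -/
lemma measureReal_sum_ge_le {N : ℕ} {W : Fin N → Ω → ℝ} (hW : ∀ i, Measurable (W i))
    (hb : ∀ i, ∀ᵐ ω ∂P, |W i ω| ≤ 1) (hind : iIndepFun W P) {m s L : ℝ}
    (hm : ∀ i, ∫ ω, W i ω ∂P = m) (hs : ∀ i, ∫ ω, W i ω ^ 2 ∂P ≤ s) (hL : 0 < L)
    (hLN : L ≤ N * s) :
    P.real {ω | N * m + 4 * √(N * s * L) ≤ ∑ i, W i ω} ≤ Real.exp (-(3 * L)) := by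
  have hNs : 0 < N * s := hL.trans_le hLN
  -- With this Chernoff parameter, t²Ns = L and t√(NsL) = L, so the exponent is -4L + L = -3L. The
  -- hypothesis `hLN` says exactly that t ≤ 1, the range of the moment generating function bound.
  set t : ℝ := √(L / (N * s)) with ht
  have ht0 : 0 ≤ t := Real.sqrt_nonneg _
  have ht1 : t ≤ 1 := Real.sqrt_le_one.2 ((div_le_one hNs).2 hLN)
  have hmgf : mgf (∑ i, W i) P t ≤ Real.exp (t * (N * m) + t ^ 2 * (N * s)) := by
    rw [hind.mgf_sum hW]
    calc ∏ i, mgf (W i) P t ≤ ∏ _i : Fin N, Real.exp (t * m + t ^ 2 * s) :=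
          Finset.prod_le_prod (fun i _ => mgf_nonneg) fun i _ => by
            rw [← hm i]
            exact mgf_le_of_abs_le_one (hW i).aemeasurable (hb i) (hs i) (by rwa [abs_of_nonneg ht0])
      _ = _ := by
          rw [Finset.prod_const, Finset.card_univ, Fintype.card_fin, ← Real.exp_nat_mul]
          congr 1
          ring
  have hint : Integrable (fun ω => Real.exp (t * (∑ i, W i) ω)) P := by
    refine hind.integrable_exp_mul_sum hW fun i _ => ?_
    refine Integrable.of_bound (by have := hW i; fun_prop) (Real.exp 1) ?_
    filter_upwards [hb i] with ω h
    rw [Real.norm_eq_abs, Real.abs_exp, Real.exp_le_exp]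
    calc t * W i ω ≤ |t * W i ω| := le_abs_self _
      _ = t * |W i ω| := by rw [abs_mul, abs_of_nonneg ht0]
      _ ≤ 1 := mul_le_one₀ ht1 (abs_nonneg _) h
  have key := measure_ge_le_exp_mul_mgf (N * m + 4 * √(N * s * L)) ht0 hint
  simp only [Finset.sum_apply] at key
  refine key.trans ((mul_le_mul_of_nonneg_left hmgf (Real.exp_pos _).le).trans ?_)
  rw [← Real.exp_add, Real.exp_le_exp]
  have h1 : t * √(N * s * L) = L := by
    rw [ht, ← Real.sqrt_mul (by positivity), ← mul_assoc, div_mul_cancel₀ _ hNs.ne',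
      Real.sqrt_mul_self hL.le]
  have h2 : t ^ 2 * (N * s) = L := by
    rw [ht, Real.sq_sqrt (by positivity), div_mul_cancel₀ _ hNs.ne']
  linarith

/-- Two-sided Bernstein inequality in the sub-Gaussian range of deviations. -/
lemma measureReal_abs_sum_sub_ge_le {N : ℕ} {W : Fin N → Ω → ℝ} (hW : ∀ i, Measurable (W i))
    (hb : ∀ i, ∀ᵐ ω ∂P, |W i ω| ≤ 1) (hind : iIndepFun W P) {m s L : ℝ}
    (hm : ∀ i, ∫ ω, W i ω ∂P = m) (hs : ∀ i, ∫ ω, W i ω ^ 2 ∂P ≤ s) (hL : 0 < L)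
    (hLN : L ≤ N * s) :
    P.real {ω | 4 * √(N * s * L) ≤ |∑ i, W i ω - N * m|} ≤ 2 * Real.exp (-(3 * L)) := by
  have h1 := measureReal_sum_ge_le hW hb hind hm hs hL hLN
  have h2 := measureReal_sum_ge_le (W := fun i ω => -W i ω) (m := -m) (fun i => (hW i).neg)
    (by simpa using hb) (hind.comp (fun _ x => -x) fun _ => measurable_neg)
    (fun i => by rw [integral_neg, hm i]) (by simpa using hs) hL hLN
  refine (measureReal_mono (s₂ := {ω | N * m + 4 * √(N * s * L) ≤ ∑ i, W i ω} ∪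
    {ω | N * -m + 4 * √(N * s * L) ≤ ∑ i, -W i ω}) ?_).trans
      ((measureReal_union_le _ _).trans (by linarith))
  intro ω hω
  rw [mem_ofPred_eq] at hω
  rcases le_abs.1 hω with h | h
  · exact Or.inl (by simp only [mem_ofPred_eq]; linarith)
  · exact Or.inr (by simp only [mem_ofPred_eq, Finset.sum_neg_distrib]; linarith)

end Concentration

/-! ### Polar coordinates and second moments on the sphere. -/

section Sphere

variable {d : ℕ}

lemma nontrivial_vec (hd : 1 ≤ d) : Nontrivial (Vec d) :=
  Module.nontrivial_of_finrank_pos (R := ℝ) (by simpa using Nat.pos_of_ne_zero (by omega))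

lemma isProbabilityMeasure_cond_toSphere (hd : 1 ≤ d) :
    IsProbabilityMeasure (ProbabilityTheory.cond (volume : Measure (Vec d)).toSphere univ) := by
  have := nontrivial_vec hd
  exact cond_isProbabilityMeasure (Measure.measure_univ_ne_zero.2 (Measure.toSphere_ne_zero _))

lemma isProbabilityMeasure_sphereUnif (hd : 1 ≤ d) (c : ℝ) :
    IsProbabilityMeasure (sphereUnif d c) := by
  have := isProbabilityMeasure_cond_toSphere hd
  exact Measure.isProbabilityMeasure_map (by fun_prop)

lemma measurableEmbedding_smul_sphere {c : ℝ} (hc : c ≠ 0) :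
    MeasurableEmbedding (fun w : sphere (0 : Vec d) 1 => c • (w : Vec d)) :=
  (measurableEmbedding_const_smul₀ hc).comp
    (MeasurableEmbedding.subtype_coe isClosed_sphere.measurableSet)

lemma integral_sphereUnif {G : Type*} [NormedAddCommGroup G] [NormedSpace ℝ G] {c : ℝ}
    (hc : c ≠ 0) (F : Vec d → G) :
    ∫ w, F w ∂(sphereUnif d c) = ((volume : Measure (Vec d)).toSphere.real univ)⁻¹ •
      ∫ θ : sphere (0 : Vec d) 1, F (c • (θ : Vec d)) ∂(volume : Measure (Vec d)).toSphere := by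
  rw [sphereUnif, (measurableEmbedding_smul_sphere hc).integral_map, ProbabilityTheory.cond,
    integral_smul_measure, Measure.restrict_univ, ENNReal.toReal_inv, measureReal_def]

lemma ae_norm_sphereUnif {c : ℝ} (hc : 0 ≤ c) : ∀ᵐ w ∂(sphereUnif d c), ‖w‖ = c := by
  rw [sphereUnif, ae_map_iff (by fun_prop) (measurableSet_eq_fun (by fun_prop) (by fun_prop))]
  refine ae_of_all _ fun θ => ?_
  simp [norm_smul, abs_of_nonneg hc]

/-- Integration over a ball in polar coordinates. -/
lemma setIntegral_ball_eq_integral_sphere {G : Type*} [NormedAddCommGroup G] [NormedSpace ℝ G]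
    (hd : 1 ≤ d) {F : Vec d → G} (hF : Continuous F) {r : ℝ} (hr : 0 ≤ r) :
    ∫ w in ball (0 : Vec d) r, F w = ∫ t in (0 : ℝ)..r, t ^ (d - 1) •
      ∫ θ : sphere (0 : Vec d) 1, F (t • (θ : Vec d)) ∂(volume : Measure (Vec d)).toSphere := by
  have := nontrivial_vec hd
  set G' : Vec d → G := (ball (0 : Vec d) r).indicator F with hG'
  have hint : Integrable G' := by
    rw [hG', integrable_indicator_iff measurableSet_ball]
    exact (hF.continuousOn.integrableOn_compact (isCompact_closedBall 0 r)).mono_set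
      ball_subset_closedBall
  have hmp := (volume : Measure (Vec d)).measurePreserving_homeomorphUnitSphereProd
  have hme := (homeomorphUnitSphereProd (Vec d)).measurableEmbedding
  let k : sphere (0 : Vec d) 1 × Ioi (0 : ℝ) → G := fun p => G' ((p.2 : ℝ) • (p.1 : Vec d))
  have hk : ∀ x : ({0}ᶜ : Set (Vec d)), k (homeomorphUnitSphereProd (Vec d) x) = G' x := by
    intro x
    have hx : ‖(x : Vec d)‖ ≠ 0 := norm_ne_zero_iff.2 x.2
    simp [k, smul_smul, mul_inv_cancel₀ hx]
  have hint' : Integrable k ((volume : Measure (Vec d)).toSphere.prod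
      (Measure.volumeIoiPow (Module.finrank ℝ (Vec d) - 1))) := by
    rw [← hmp.integrable_comp_emb hme]
    have : k ∘ homeomorphUnitSphereProd (Vec d) = G' ∘ Subtype.val := funext hk
    rw [this, ← integrableOn_iff_comap_subtypeVal (measurableSet_singleton _).compl]
    exact hint.integrableOn
  calc ∫ w in ball (0 : Vec d) r, F w = ∫ w, G' w := (integral_indicator measurableSet_ball).symm
    -- Polar coordinates live on the punctured space; the origin is a null set because d ≥ 1.
    _ = ∫ x : ({0}ᶜ : Set (Vec d)), G' x ∂(volume.comap Subtype.val) := by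
        rw [integral_subtype_comap (measurableSet_singleton _).compl G',
          restrict_compl_singleton]
    _ = ∫ p, k p ∂((volume : Measure (Vec d)).toSphere.prod
          (Measure.volumeIoiPow (Module.finrank ℝ (Vec d) - 1))) := by
        rw [← hmp.integral_comp hme]
        simp_rw [hk]
    _ = ∫ t : Ioi (0 : ℝ), (∫ θ, k (θ, t) ∂(volume : Measure (Vec d)).toSphere)
          ∂(Measure.volumeIoiPow (Module.finrank ℝ (Vec d) - 1)) := integral_prod_symm _ hint'
    _ = ∫ t in Ioi (0 : ℝ), t ^ (d - 1) •
          ∫ θ : sphere (0 : Vec d) 1, G' (t • (θ : Vec d)) ∂(volume : Measure (Vec d)).toSphere := by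
        simp only [Measure.volumeIoiPow, ENNReal.ofReal, finrank_euclideanSpace, Fintype.card_fin, k]
        rw [integral_withDensity_eq_integral_smul (by fun_prop),
          integral_subtype_comap measurableSet_Ioi fun t : ℝ => Real.toNNReal (t ^ (d - 1)) •
            ∫ θ : sphere (0 : Vec d) 1, G' (t • (θ : Vec d)) ∂(volume : Measure (Vec d)).toSphere]
        refine setIntegral_congr_fun measurableSet_Ioi fun t ht => ?_
        simp only [NNReal.smul_def, Real.coe_toNNReal _ (pow_nonneg (le_of_lt ht) _)]
    _ = ∫ t in Ioi (0 : ℝ), (Iio r).indicator (fun t => t ^ (d - 1) •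
          ∫ θ : sphere (0 : Vec d) 1, F (t • (θ : Vec d)) ∂(volume : Measure (Vec d)).toSphere) t := by
        refine setIntegral_congr_fun measurableSet_Ioi fun t ht => ?_
        have ht' : |t| = t := abs_of_pos ht
        by_cases h : t < r
        · simp [hG', indicator, norm_smul, ht', h]
        · simp [hG', indicator, norm_smul, ht', h]
    _ = _ := by
        rw [setIntegral_indicator measurableSet_Iio, intervalIntegral.integral_of_le hr,
          Ioi_inter_Iio, integral_Ioc_eq_integral_Ioo]

/-- Rotation invariance is inherited from Lebesgue measure: polar coordinates turn the sphere
integral into d + 2 times a ball integral, and the reflection in the hyperplane orthogonal to u - v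
preserves volume and the ball while sending u to v. -/
lemma integral_toSphere_inner_sq_eq_of_norm_eq (hd : 1 ≤ d) {u v : Vec d} (h : ‖u‖ = ‖v‖) :
    ∫ θ : sphere (0 : Vec d) 1, ⟪(θ : Vec d), u⟫ ^ 2 ∂(volume : Measure (Vec d)).toSphere
      = ∫ θ : sphere (0 : Vec d) 1, ⟪(θ : Vec d), v⟫ ^ 2 ∂(volume : Measure (Vec d)).toSphere := by
  have polar : ∀ u : Vec d, ∫ w in ball (0 : Vec d) 1, ⟪w, u⟫ ^ 2 = (1 / (d + 2 : ℝ)) *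
      ∫ θ : sphere (0 : Vec d) 1, ⟪(θ : Vec d), u⟫ ^ 2 ∂(volume : Measure (Vec d)).toSphere := by
    intro u
    rw [setIntegral_ball_eq_integral_sphere hd (by fun_prop) zero_le_one]
    have : ∀ t : ℝ, t ^ (d - 1) • ∫ θ : sphere (0 : Vec d) 1, ⟪t • (θ : Vec d), u⟫ ^ 2
        ∂(volume : Measure (Vec d)).toSphere = t ^ (d + 1) * ∫ θ : sphere (0 : Vec d) 1,
          ⟪(θ : Vec d), u⟫ ^ 2 ∂(volume : Measure (Vec d)).toSphere := by
      intro t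
      simp only [real_inner_smul_left, mul_pow, integral_const_mul, smul_eq_mul, ← mul_assoc,
        ← pow_add]
      congr 2
      omega
    simp only [this, intervalIntegral.integral_mul_const, integral_pow]
    norm_num [add_assoc]
  let ρ : Vec d ≃ₗᵢ[ℝ] Vec d := Submodule.reflection (ℝ ∙ (u - v))ᗮ
  have hρ : ρ u = v := Submodule.reflection_sub h
  have hball : ρ ⁻¹' ball (0 : Vec d) 1 = ball 0 1 := by
    ext w
    simp
  have hrot : ∫ w in ball (0 : Vec d) 1, ⟪w, u⟫ ^ 2 = ∫ w in ball (0 : Vec d) 1, ⟪w, v⟫ ^ 2 := by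
    rw [← ρ.measurePreserving.setIntegral_preimage_emb ρ.toHomeomorph.measurableEmbedding
      (fun w => ⟪w, v⟫ ^ 2), hball, ← hρ]
    simp
  rw [polar, polar] at hrot
  exact mul_left_cancel₀ (by positivity) hrot

/-- The second moments of the uniform law on a sphere. -/
lemma integral_sphereUnif_inner_sq (hd : 1 ≤ d) {c : ℝ} (hc : 0 < c) (u : Vec d) :
    ∫ w, ⟪w, u⟫ ^ 2 ∂(sphereUnif d c) = c ^ 2 * ‖u‖ ^ 2 / d := by
  have := isProbabilityMeasure_sphereUnif hd c
  have hint : ∀ v : Vec d, Integrable (fun w : Vec d => ⟪w, v⟫ ^ 2) (sphereUnif d c) := fun v => by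
    refine Integrable.of_bound (by fun_prop) ((c * ‖v‖) ^ 2) ?_
    filter_upwards [ae_norm_sphereUnif hc.le] with w hw
    rw [norm_pow]
    gcongr
    exact hw ▸ norm_inner_le_norm w v
  have hrot : ∀ v : Vec d, ‖u‖ = ‖v‖ →
      ∫ w, ⟪w, u⟫ ^ 2 ∂(sphereUnif d c) = ∫ w, ⟪w, v⟫ ^ 2 ∂(sphereUnif d c) := fun v h => by
    simp only [integral_sphereUnif hc.ne', real_inner_smul_left, mul_pow, integral_const_mul,
      integral_toSphere_inner_sq_eq_of_norm_eq hd h]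
  -- The d coordinate vectors rescaled to length ‖u‖ all have the same second moment as u, and
  -- together these add up to ‖u‖² E‖w‖² = c²‖u‖².
  have hsum : ∑ i : Fin d, ∫ w, ⟪w, EuclideanSpace.single i ‖u‖⟫ ^ 2 ∂(sphereUnif d c)
      = c ^ 2 * ‖u‖ ^ 2 := by
    rw [← integral_finsetSum _ fun i _ => hint _]
    have : ∀ᵐ w ∂(sphereUnif d c),
        ∑ i : Fin d, ⟪w, EuclideanSpace.single i ‖u‖⟫ ^ 2 = c ^ 2 * ‖u‖ ^ 2 := by
      filter_upwards [ae_norm_sphereUnif hc.le] with w hw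
      simp only [EuclideanSpace.inner_single_right, mul_pow, ← Finset.mul_sum]
      rw [← hw, EuclideanSpace.real_norm_sq_eq w]
      simp [mul_comm]
    rw [integral_congr_ae this]
    simp
  have hd' : (d : ℝ) ≠ 0 := by positivity
  rw [eq_div_iff hd', mul_comm, ← hsum, Finset.sum_congr rfl fun i _ =>
    (hrot (EuclideanSpace.single i ‖u‖) (by simp)).symm]
  simp

end Sphere

/-! ### Differentiating a ball average of a continuous function. -/

section Smoothing

open Filter Topology

variable {d : ℕ}

/-- Writing (r² - x²)⁺ = r² - min(x, r)² makes the difference factor. This Lipschitz bound dominates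
the difference quotients when differentiating under the integral. -/
lemma abs_max_sq_sub_sub_le {r : ℝ} (hr : 0 ≤ r) {a b : ℝ} (ha : 0 ≤ a) (hb : 0 ≤ b) :
    |max (r ^ 2 - a ^ 2) 0 - max (r ^ 2 - b ^ 2) 0| ≤ 2 * r * |a - b| := by
  have key : ∀ x : ℝ, 0 ≤ x → max (r ^ 2 - x ^ 2) 0 = r ^ 2 - min x r ^ 2 := fun x hx => by
    rcases le_total x r with h | h
    · rw [min_eq_left h, max_eq_left (sub_nonneg.2 (by gcongr))]
    · rw [min_eq_right h, sub_self, max_eq_right (sub_nonpos.2 (by gcongr))]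
  rw [key a ha, key b hb, show r ^ 2 - min a r ^ 2 - (r ^ 2 - min b r ^ 2)
    = (min a r + min b r) * (min b r - min a r) by ring, abs_mul, abs_sub_comm (min b r)]
  have h1 : |min a r + min b r| ≤ 2 * r := by
    rw [abs_of_nonneg (by positivity)]
    linarith [min_le_right a r, min_le_right b r]
  have h2 : |min a r - min b r| ≤ |a - b| := by simpa using abs_min_sub_min_le_max a r b r
  exact mul_le_mul h1 h2 (abs_nonneg _) (by positivity)

/-- The integral of `g` against the truncated paraboloid of radius `r` centred at `x` is
differentiable in `x`. -/
lemma hasFDerivAt_integral_mul_max {g : Vec d → ℝ} (hg : Continuous g) {r : ℝ} (hr : 0 < r)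
    (x₀ : Vec d) :
    HasFDerivAt (fun x => ∫ y, g y * max (r ^ 2 - ‖y - x‖ ^ 2) 0)
      (innerSL ℝ (∫ w in ball (0 : Vec d) r, (2 * g (x₀ + w)) • w)) x₀ := by
  -- The gradient in x, at x₀, of the integrand g(y)(r² - ‖y - x‖²)⁺, for y off the sphere of radius
  -- r.
  let v : Vec d → Vec d := (ball x₀ r).indicator fun y => (2 * g y) • (y - x₀)
  have hv : Continuous fun y => (2 * g y) • (y - x₀) := by fun_prop
  have hvint : Integrable v := by
    rw [integrable_indicator_iff measurableSet_ball]
    exact (hv.continuousOn.integrableOn_compact (isCompact_closedBall x₀ r)).mono_set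
      ball_subset_closedBall
  have hveq : ∫ y, v y = ∫ w in ball (0 : Vec d) r, (2 * g (x₀ + w)) • w := by
    rw [← integral_add_left_eq_self v x₀, ← integral_indicator measurableSet_ball]
    refine integral_congr_ae (ae_of_all _ fun w => ?_)
    simp [v, indicator, mem_ball, dist_eq_norm]
  -- For x within distance 1 of x₀ the kernel vanishes outside this larger ball.
  have hbound : Integrable ((closedBall x₀ (r + 1)).indicator fun y => |g y| * (2 * r)) := by
    rw [integrable_indicator_iff measurableSet_closedBall]
    exact ContinuousOn.integrableOn_compact (isCompact_closedBall _ _) (by fun_prop)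
  have hmain := hasFDerivAt_integral_of_dominated_loc_of_lip' (μ := volume) (𝕜 := ℝ)
    (F := fun x y => g y * max (r ^ 2 - ‖y - x‖ ^ 2) 0) (F' := fun y => innerSL ℝ (v y))
    (bound := (closedBall x₀ (r + 1)).indicator fun y => |g y| * (2 * r))
    (ball_mem_nhds x₀ one_pos) (fun x _ => Continuous.aestronglyMeasurable (by fun_prop)) ?_
    ((innerSL ℝ).continuous.comp_aestronglyMeasurable hvint.aestronglyMeasurable) ?_ hbound ?_
  · have h := hmain.2
    rwa [ContinuousLinearMap.integral_comp_comm (innerSL ℝ : Vec d →L[ℝ] _) hvint, hveq] at h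
  · refine Continuous.integrable_of_hasCompactSupport (by fun_prop)
      (HasCompactSupport.intro (isCompact_closedBall x₀ r) fun y hy => ?_)
    rw [mem_closedBall, dist_eq_norm, not_le] at hy
    rw [max_eq_right (sub_nonpos.2 (by gcongr)), mul_zero]
  · refine ae_of_all _ fun y x hx => ?_
    rw [mem_ball, dist_eq_norm] at hx
    by_cases hy : y ∈ closedBall x₀ (r + 1)
    · rw [indicator_of_mem hy, ← mul_sub, norm_mul, Real.norm_eq_abs, Real.norm_eq_abs, mul_assoc]
      gcongr
      refine (abs_max_sq_sub_sub_le hr.le (norm_nonneg _) (norm_nonneg _)).trans ?_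
      gcongr
      have := abs_norm_sub_norm_le (y - x) (y - x₀)
      rwa [sub_sub_sub_cancel_left, norm_sub_rev x₀ x] at this
    · rw [indicator_of_notMem hy, zero_mul]
      rw [mem_closedBall, dist_eq_norm, not_le] at hy
      have h1 : r ≤ ‖y - x‖ := by
        have := norm_sub_le_norm_sub_add_norm_sub y x x₀
        linarith
      have h2 : r ≤ ‖y - x₀‖ := by linarith
      rw [max_eq_right (sub_nonpos.2 (by gcongr)), max_eq_right (sub_nonpos.2 (by gcongr))]
      simp
  -- The truncated kernel has a kink only on a sphere, which is null; inside it is a polynomial near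
  -- x₀, outside it is locally zero.
  · have hnull : ∀ᵐ y : Vec d, ‖y - x₀‖ ≠ r := by
      filter_upwards [measure_eq_zero_iff_ae_notMem.1
        (Measure.addHaar_sphere_of_ne_zero volume x₀ hr.ne')] with y hy
      rwa [← dist_eq_norm]
    filter_upwards [hnull] with y hy
    rcases lt_or_gt_of_ne hy with h | h
    · have hvy : v y = (2 * g y) • (y - x₀) := indicator_of_mem (by rwa [mem_ball, dist_eq_norm]) _
      have hev : (fun x => g y * max (r ^ 2 - ‖y - x‖ ^ 2) 0) =ᶠ[𝓝 x₀]
          fun x => g y * (r ^ 2 - ‖y - x‖ ^ 2) := by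
        have : ∀ᶠ x in 𝓝 x₀, ‖y - x‖ < r :=
          (by fun_prop : Continuous fun x => ‖y - x‖).continuousAt.eventually_lt_const h
        filter_upwards [this] with x hx
        rw [max_eq_left (sub_nonneg.2 (by gcongr))]
      refine HasFDerivAt.congr_of_eventuallyEq ?_ hev
      have h1 := ((((hasFDerivAt_id x₀).const_sub y).norm_sq).const_sub (r ^ 2)).const_mul (g y)
      refine h1.congr_fderiv ?_
      ext w
      simp [hvy]
      ring
    · have hvy : v y = 0 := indicator_of_notMem (by rw [mem_ball, dist_eq_norm]; linarith) _
      have hev : (fun x => g y * max (r ^ 2 - ‖y - x‖ ^ 2) 0) =ᶠ[𝓝 x₀] fun _ => 0 := by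
        have : ∀ᶠ x in 𝓝 x₀, r < ‖y - x‖ :=
          (by fun_prop : Continuous fun x => ‖y - x‖).continuousAt.eventually_const_lt h
        filter_upwards [this] with x hx
        rw [max_eq_right (sub_nonpos.2 (by gcongr)), mul_zero]
      rw [hvy, map_zero]
      exact (hasFDerivAt_const (0 : ℝ) x₀).congr_of_eventuallyEq hev

/-- The flux vector of `g` through the sphere of centre `x` and radius `r`. -/
noncomputable def sphereFlux (g : Vec d → ℝ) (x : Vec d) (r : ℝ) : Vec d :=
  ∫ θ : sphere (0 : Vec d) 1, (r ^ (d - 1) * g (x + r • (θ : Vec d))) • (θ : Vec d)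
    ∂(volume : Measure (Vec d)).toSphere

lemma continuous_sphereFlux {g : Vec d → ℝ} (hg : Continuous g) :
    Continuous fun p : Vec d × ℝ => sphereFlux g p.1 p.2 := by
  have := continuous_parametric_integral_of_continuous
    (μ := (volume : Measure (Vec d)).toSphere) (s := (univ : Set (sphere (0 : Vec d) 1)))
    (f := fun (p : Vec d × ℝ) (θ : sphere (0 : Vec d) 1) =>
      (p.2 ^ (d - 1) * g (p.1 + p.2 • (θ : Vec d))) • (θ : Vec d)) (by fun_prop) isCompact_univ
  simpa only [Measure.restrict_univ] using! this

/-- In polar coordinates w = tθ, the extra factor t joins the 2 to form the weight 2t, whose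
integral over [c, b] is b² - c². This is why paraboloids are the convenient kernels. -/
lemma setIntegral_ball_smul_eq_integral_sphereFlux (hd : 1 ≤ d) {g : Vec d → ℝ}
    (hg : Continuous g) {r : ℝ} (hr : 0 ≤ r) (x : Vec d) :
    ∫ w in ball (0 : Vec d) r, (2 * g (x + w)) • w
      = ∫ t in (0 : ℝ)..r, (2 * t) • sphereFlux g x t := by
  rw [setIntegral_ball_eq_integral_sphere hd (by fun_prop) hr]
  refine intervalIntegral.integral_congr fun t _ => ?_
  simp only [sphereFlux]
  rw [← integral_smul, ← integral_smul]
  refine integral_congr_ae (ae_of_all _ fun θ => ?_)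
  simp only [smul_smul]
  congr 1
  ring

/-- Averages of the flux over thin shells converge, locally uniformly, to the flux. -/
lemma tendstoUniformlyOnFilter_shell (hd : 1 ≤ d) {g : Vec d → ℝ} (hg : Continuous g) {c : ℝ}
    (hc : 0 < c) (x₀ : Vec d) :
    TendstoUniformlyOnFilter
      (fun (b : ℝ) (x : Vec d) => innerSL ℝ ((b ^ 2 - c ^ 2)⁻¹ •
        ((∫ w in ball (0 : Vec d) b, (2 * g (x + w)) • w)
          - ∫ w in ball (0 : Vec d) c, (2 * g (x + w)) • w)))
      (fun x => innerSL ℝ (sphereFlux g x c)) (𝓝[>] c) (𝓝 x₀) := by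
  rw [Metric.tendstoUniformlyOnFilter_iff]
  intro ε hε
  have hcont := (continuous_sphereFlux hg).continuousAt (x := (x₀, c))
  obtain ⟨η, hη, hclose⟩ := Metric.continuousAt_iff.1 hcont (ε / 3) (by positivity)
  have h1 : ∀ᶠ b in 𝓝[>] c, b ∈ Ioo c (c + η) := Ioo_mem_nhdsGT (by linarith)
  have h2 : ∀ᶠ x in 𝓝 x₀, x ∈ ball x₀ η := ball_mem_nhds x₀ hη
  filter_upwards [h1.prod_mk h2] with p hp
  obtain ⟨⟨hb, hb'⟩, hx⟩ := hp
  set b := p.1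
  set x := p.2
  -- Both fluxes are compared with the one at (x₀, c), using joint continuity in centre and radius;
  -- this makes the estimate uniform in x.
  have hnear : ∀ t ∈ Icc c b, ‖sphereFlux g x t - sphereFlux g x c‖ ≤ 2 * (ε / 3) := by
    intro t ht
    have ht1 := hclose (x := (x, t)) (by
      rw [Prod.dist_eq, max_lt_iff]
      exact ⟨hx, by rw [Real.dist_eq, abs_of_nonneg (by linarith [ht.1])]; linarith [ht.2]⟩)
    have ht2 := hclose (x := (x, c)) (by
      rw [Prod.dist_eq, max_lt_iff]
      exact ⟨hx, by simpa using hη⟩)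
    rw [← dist_eq_norm]
    linarith [dist_triangle_right (sphereFlux g x t) (sphereFlux g x c) (sphereFlux g x₀ c)]
  have hflux : Continuous fun t => sphereFlux g x t :=
    (continuous_sphereFlux hg).comp (Continuous.prodMk_right x)
  have hii : ∀ a a' : ℝ, IntervalIntegrable (fun t => (2 * t) • sphereFlux g x t) volume a a' :=
    fun a a' => Continuous.intervalIntegrable (by fun_prop) _ _
  have hpos : 0 < b ^ 2 - c ^ 2 := sub_pos.2 (by gcongr)
  have hlin : ∫ t in c..b, 2 * t = b ^ 2 - c ^ 2 := by
    rw [intervalIntegral.integral_const_mul, integral_id]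
    ring
  have hdiff : (b ^ 2 - c ^ 2)⁻¹ • ((∫ w in ball (0 : Vec d) b, (2 * g (x + w)) • w)
      - ∫ w in ball (0 : Vec d) c, (2 * g (x + w)) • w) - sphereFlux g x c
      = (b ^ 2 - c ^ 2)⁻¹ • ∫ t in c..b, (2 * t) • (sphereFlux g x t - sphereFlux g x c) := by
    rw [setIntegral_ball_smul_eq_integral_sphereFlux hd hg (hc.trans hb).le,
      setIntegral_ball_smul_eq_integral_sphereFlux hd hg hc.le,
      intervalIntegral.integral_interval_sub_left (hii _ _) (hii _ _)]
    simp_rw [smul_sub]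
    rw [intervalIntegral.integral_sub (hii _ _)
      (Continuous.intervalIntegrable (by fun_prop) _ _), intervalIntegral.integral_smul_const,
      hlin, smul_sub, smul_smul, inv_mul_cancel₀ hpos.ne', one_smul]
  rw [dist_comm, dist_eq_norm, ← map_sub, innerSL_apply_norm, hdiff, norm_smul,
    Real.norm_of_nonneg (inv_nonneg.2 hpos.le)]
  have hle : ‖∫ t in c..b, (2 * t) • (sphereFlux g x t - sphereFlux g x c)‖
      ≤ ∫ t in c..b, 2 * t * (2 * (ε / 3)) := by
    refine intervalIntegral.norm_integral_le_of_norm_le hb.le (ae_of_all _ fun t ht => ?_)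
      (Continuous.intervalIntegrable (by fun_prop) _ _)
    have ht0 : 0 ≤ 2 * t := by linarith [ht.1]
    rw [norm_smul, Real.norm_of_nonneg ht0]
    gcongr
    exact hnear t (Ioc_subset_Icc_self ht)
  rw [intervalIntegral.integral_mul_const, hlin] at hle
  calc (b ^ 2 - c ^ 2)⁻¹ * ‖∫ t in c..b, (2 * t) • (sphereFlux g x t - sphereFlux g x c)‖
      ≤ (b ^ 2 - c ^ 2)⁻¹ * ((b ^ 2 - c ^ 2) * (2 * (ε / 3))) := by gcongr
    _ = 2 * (ε / 3) := by field_simp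
    _ < ε := by linarith

/-- The normalised difference of paraboloids is 1 on the closed ball of radius c, 0 outside radius
b, and at most 1 between, so dominated convergence replaces it by the indicator of the ball. -/
lemma tendsto_shell {g : Vec d → ℝ} (hg : Continuous g) {c : ℝ} (hc : 0 < c) (x : Vec d) :
    Tendsto (fun b : ℝ => (b ^ 2 - c ^ 2)⁻¹ • ((∫ y, g y * max (b ^ 2 - ‖y - x‖ ^ 2) 0)
      - ∫ y, g y * max (c ^ 2 - ‖y - x‖ ^ 2) 0)) (𝓝[>] c)
      (𝓝 (∫ w in closedBall (0 : Vec d) c, g (x + w))) := by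
  have hint : ∀ r : ℝ, 0 ≤ r → Integrable fun y => g y * max (r ^ 2 - ‖y - x‖ ^ 2) 0 := by
    intro r hr
    refine Continuous.integrable_of_hasCompactSupport (by fun_prop)
      (HasCompactSupport.intro (isCompact_closedBall x r) fun y hy => ?_)
    rw [mem_closedBall, dist_eq_norm, not_le] at hy
    rw [max_eq_right (sub_nonpos.2 (by gcongr)), mul_zero]
  have hlim : ∫ w in closedBall (0 : Vec d) c, g (x + w)
      = ∫ y, (closedBall x c).indicator g y := by
    rw [← integral_add_left_eq_self ((closedBall x c).indicator g) x,
      ← integral_indicator measurableSet_closedBall]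
    refine integral_congr_ae (ae_of_all _ fun w => ?_)
    simp [indicator, mem_closedBall, dist_eq_norm]
  have hev : ∀ᶠ b in 𝓝[>] c, b ∈ Ioo c (c + 1) := Ioo_mem_nhdsGT (by linarith)
  rw [hlim]
  have heq : ∀ᶠ b in 𝓝[>] c, ∫ y, (b ^ 2 - c ^ 2)⁻¹ * (g y * max (b ^ 2 - ‖y - x‖ ^ 2) 0
      - g y * max (c ^ 2 - ‖y - x‖ ^ 2) 0) = (b ^ 2 - c ^ 2)⁻¹ •
      ((∫ y, g y * max (b ^ 2 - ‖y - x‖ ^ 2) 0) - ∫ y, g y * max (c ^ 2 - ‖y - x‖ ^ 2) 0) := by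
    filter_upwards [hev] with b hb
    rw [integral_const_mul, integral_sub (hint b (hc.trans hb.1).le) (hint c hc.le), smul_eq_mul]
  refine Tendsto.congr' heq ?_
  refine tendsto_integral_filter_of_dominated_convergence
    ((closedBall x (c + 1)).indicator fun y => |g y|) ?_ ?_ ?_ ?_
  · exact Eventually.of_forall fun b => Continuous.aestronglyMeasurable (by fun_prop)
  · filter_upwards [hev] with b hb
    refine ae_of_all _ fun y => ?_
    have hpos : 0 < b ^ 2 - c ^ 2 := sub_pos.2 (pow_lt_pow_left₀ hb.1 hc.le two_ne_zero)
    by_cases hy : y ∈ closedBall x (c + 1)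
    · rw [indicator_of_mem hy, ← mul_sub, norm_mul, norm_mul, Real.norm_eq_abs, Real.norm_eq_abs,
        Real.norm_eq_abs, abs_of_pos (inv_pos.2 hpos), inv_mul_le_iff₀ hpos, mul_comm]
      gcongr
      refine (abs_max_sub_max_le_abs _ _ _).trans ?_
      rw [sub_sub_sub_cancel_right, abs_of_pos hpos]
    · rw [indicator_of_notMem hy]
      rw [mem_closedBall, dist_eq_norm, not_le] at hy
      have h1 : b ≤ ‖y - x‖ := by linarith [hb.2]
      have h2 : c ≤ ‖y - x‖ := by linarith
      have hb0 : 0 ≤ b := (hc.trans hb.1).le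
      rw [max_eq_right (sub_nonpos.2 (by gcongr)), max_eq_right (sub_nonpos.2 (by gcongr))]
      simp
  · rw [integrable_indicator_iff measurableSet_closedBall]
    exact ContinuousOn.integrableOn_compact (isCompact_closedBall _ _) (by fun_prop)
  · refine ae_of_all _ fun y => tendsto_const_nhds.congr' ?_
    by_cases hy : y ∈ closedBall x c
    · rw [indicator_of_mem hy]
      rw [mem_closedBall, dist_eq_norm] at hy
      filter_upwards [hev] with b hb
      have hpos : 0 < b ^ 2 - c ^ 2 := sub_pos.2 (pow_lt_pow_left₀ hb.1 hc.le two_ne_zero)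
      have h1 : ‖y - x‖ ≤ b := hy.trans hb.1.le
      rw [max_eq_left (sub_nonneg.2 (by gcongr)), max_eq_left (sub_nonneg.2 (by gcongr))]
      field_simp
      ring
    · rw [indicator_of_notMem hy]
      rw [mem_closedBall, dist_eq_norm, not_le] at hy
      have hev' : ∀ᶠ b in 𝓝[>] c, b ∈ Ioo c ‖y - x‖ := Ioo_mem_nhdsGT hy
      filter_upwards [hev'] with b hb
      have h1 : b ≤ ‖y - x‖ := hb.2.le
      have hb0 : 0 ≤ b := (hc.trans hb.1).le
      rw [max_eq_right (sub_nonpos.2 (by gcongr)), max_eq_right (sub_nonpos.2 (by gcongr))]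
      simp

/-- A pointwise limit of differentiable functions whose derivatives converge locally uniformly is
differentiable, with the limit as derivative. -/
lemma hasFDerivAt_setIntegral_closedBall (hd : 1 ≤ d) {g : Vec d → ℝ} (hg : Continuous g) {c : ℝ}
    (hc : 0 < c) (x : Vec d) :
    HasFDerivAt (fun x => ∫ w in closedBall (0 : Vec d) c, g (x + w))
      (innerSL ℝ (sphereFlux g x c)) x := by
  refine hasFDerivAt_of_tendstoUniformlyOnFilter (l := 𝓝[>] c)
    (g' := fun x => innerSL ℝ (sphereFlux g x c)) (tendstoUniformlyOnFilter_shell hd hg hc x) ?_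
    (Eventually.of_forall fun y => tendsto_shell hg hc y)
  have hev : ∀ᶠ b in 𝓝[>] c, b ∈ Ioi c := self_mem_nhdsWithin
  filter_upwards [hev.prod_inl (𝓝 x)] with p hp
  have h := ((hasFDerivAt_integral_mul_max hg (hc.trans hp) p.2).sub
    (hasFDerivAt_integral_mul_max hg hc p.2)).const_smul (p.1 ^ 2 - c ^ 2)⁻¹
  rwa [← map_sub, ← map_smul] at h

end Smoothing

/-! ### The gradient of the smoothed function as a spherical mean. -/

section Gradient

open Topology

variable {d : ℕ}

lemma smooth_eq_setIntegral {c : ℝ} (hc : c ≠ 0) (g : Vec d → ℝ) (x : Vec d) :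
    smooth g c x = (volume.real (closedBall (0 : Vec d) c))⁻¹ •
      ∫ w in closedBall (0 : Vec d) c, g (x + w) := by
  rw [smooth, ballUnif, if_neg hc, unif, ProbabilityTheory.cond, integral_smul_measure,
    ENNReal.toReal_inv, measureReal_def]

/-- The unit sphere has area d times the volume of the unit ball, which absorbs the factor d; the
powers of c match by scaling. -/
lemma sphereMean_eq_sphereFlux (hd : 1 ≤ d) {c : ℝ} (hc : 0 < c) (g : Vec d → ℝ) (x : Vec d) :
    sphereMean g c x = (volume.real (closedBall (0 : Vec d) c))⁻¹ • sphereFlux g x c := by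
  have hball : volume.real (ball (0 : Vec d) 1) ≠ 0 := by
    rw [measureReal_def]
    exact (ENNReal.toReal_pos (measure_ball_pos _ _ one_pos).ne' measure_ball_lt_top.ne).ne'
  have hvol : volume.real (closedBall (0 : Vec d) c)
      = c ^ d * volume.real (ball (0 : Vec d) 1) := by
    rw [measureReal_def, Measure.addHaar_closedBall _ _ hc.le, ENNReal.toReal_mul,
      ENNReal.toReal_ofReal (by positivity), finrank_euclideanSpace, Fintype.card_fin,
      measureReal_def]
  rw [sphereMean, integral_sphereUnif hc.ne', sphereFlux, hvol,
    Measure.toSphere_real_apply_univ, finrank_euclideanSpace, Fintype.card_fin]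
  simp only [mul_smul, smul_comm (g _) c]
  rw [integral_smul, integral_smul]
  simp only [smul_smul]
  congr 1
  obtain ⟨k, rfl⟩ : ∃ k, d = k + 1 := ⟨d - 1, by omega⟩
  have : ((k + 1 : ℕ) : ℝ) ≠ 0 := by positivity
  rw [Nat.add_sub_cancel]
  field_simp
  ring

lemma hasGradientAt_smooth_of_continuous (hd : 1 ≤ d) {g : Vec d → ℝ} (hg : Continuous g) {c : ℝ}
    (hc : 0 < c) (x : Vec d) : HasGradientAt (smooth g c) (sphereMean g c x) x := by
  rw [hasGradientAt_iff_hasFDerivAt, sphereMean_eq_sphereFlux hd hc]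
  have h := (hasFDerivAt_setIntegral_closedBall hd hg hc x).const_smul
    (volume.real (closedBall (0 : Vec d) c))⁻¹
  rw [← map_smul] at h
  refine HasFDerivAt.congr_of_eventuallyEq ?_ (Filter.Eventually.of_forall fun y =>
    smooth_eq_setIntegral hc.ne' g y)
  exact h

/-- The ball average of `g` is differentiable at `z`, with the spherical mean as its gradient, if
`g` is continuous on a neighbourhood of the closed ball. -/
lemma hasGradientAt_smooth (hd : 1 ≤ d) {g : Vec d → ℝ} {U : Set (Vec d)} (hU : IsOpen U)
    (hg : ContinuousOn g U) {c : ℝ} (hc : 0 < c) {z : Vec d} (hz : closedBall z c ⊆ U) :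
    HasGradientAt (smooth g c) (sphereMean g c z) z := by
  obtain ⟨η, hη, hsub⟩ := (isCompact_closedBall z c).exists_cthickening_subset_open hU hz
  rw [cthickening_closedBall hη.le hc.le] at hsub
  -- Tietze extension from a slightly larger closed ball: the global continuous `G` has the same
  -- ball averages as `g` at all centres within η of z, and the same spherical mean at z.
  obtain ⟨G, hG⟩ := ContinuousMap.exists_restrict_eq (isClosed_closedBall (x := z) (ε := η + c))
    ⟨(closedBall z (η + c)).domRestrict g, (hg.mono hsub).domRestrict⟩
  have heq : ∀ y ∈ closedBall z (η + c), G y = g y := fun y hy =>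
    DFunLike.congr_fun hG (⟨y, hy⟩ : closedBall z (η + c))
  have hmem : ∀ x ∈ ball z η, ∀ w : Vec d, ‖w‖ ≤ c → x + w ∈ closedBall z (η + c) := by
    intro x hx w hw
    rw [mem_ball, dist_eq_norm] at hx
    rw [mem_closedBall, dist_eq_norm, add_sub_right_comm]
    exact (norm_add_le _ _).trans (by linarith)
  have hmean : sphereMean g c z = sphereMean G c z := by
    unfold sphereMean
    congr 1
    refine integral_congr_ae ?_
    filter_upwards [ae_norm_sphereUnif hc.le] with w hw
    rw [heq _ (hmem z (mem_ball_self hη) w hw.le)]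
  rw [hmean]
  refine (hasGradientAt_smooth_of_continuous hd G.continuous hc z).congr_of_eventuallyEq ?_
  filter_upwards [ball_mem_nhds z hη] with x hx
  rw [smooth_eq_setIntegral hc.ne', smooth_eq_setIntegral hc.ne']
  congr 1
  refine setIntegral_congr_fun measurableSet_closedBall fun w hw => ?_
  exact (heq _ (hmem x hx w (mem_closedBall_zero_iff.1 hw))).symm

end Gradient

/-! ### Means and concentration of the estimators. -/

section Sampling

variable {Ω : Type*} {mΩ : MeasurableSpace Ω} {P : Measure Ω} {d N : ℕ}

lemma ae_norm_le_ballUnif {c : ℝ} (hc : 0 ≤ c) : ∀ᵐ w ∂(ballUnif d c), ‖w‖ ≤ c := by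
  rcases hc.eq_or_lt with rfl | hc
  · rw [ballUnif, if_pos rfl, ae_dirac_iff (measurableSet_le (by fun_prop) (by fun_prop))]
    simp
  · rw [ballUnif, if_neg hc.ne']
    filter_upwards [ProbabilityTheory.ae_cond_mem measurableSet_closedBall] with w hw
    exact mem_closedBall_zero_iff.1 hw

/-- `f` is arbitrary outside `S`, so the composite is cut off to `B`, where ν is concentrated. -/
lemma aestronglyMeasurable_comp_of_ae_mem {S : Set (Vec d)} {f : Vec d → ℝ}
    (hf : Measurable (S.domRestrict f)) {q : Vec d → Vec d} (hq : Measurable q)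
    {B : Set (Vec d)} (hB : MeasurableSet B) (hqB : MapsTo q B S) {ν : Measure (Vec d)}
    (hν : ∀ᵐ w ∂ν, w ∈ B) : AEStronglyMeasurable (fun w => f (q w)) ν := by
  have hmeas : Measurable (B.indicator fun w => f (q w)) := by
    refine measurable_of_restrict_of_restrict_compl hB ?_ ?_
    · have : B.domRestrict (B.indicator fun w => f (q w)) = fun w : B => f (q w) := by
        funext w
        simp [Set.domRestrict]
      rw [this]
      exact hf.comp ((hq.comp measurable_subtype_coe).subtype_mk (h := fun w => hqB w.2))
    · have : Bᶜ.domRestrict (B.indicator fun w => f (q w)) = fun _ => 0 := by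
        funext w
        exact indicator_of_notMem w.2 _
      rw [this]
      exact measurable_const
  refine ⟨_, hmeas.stronglyMeasurable, ?_⟩
  filter_upwards [hν] with w hw
  rw [indicator_of_mem hw]

namespace IsNoisySample

variable {ν : Measure (Vec d)} {f : Vec d → ℝ} {q : Vec d → Vec d}
  {Z : Fin N → Ω → Vec d} {Y : Fin N → Ω → ℝ}

lemma ae_Z (h : IsNoisySample P ν f q Z Y) {p : Vec d → Prop} (hp : ∀ᵐ w ∂ν, p w) (i : Fin N) :
    ∀ᵐ ω ∂P, p (Z i ω) :=
  ae_of_ae_map (h.measurable_Z i).aemeasurable (by rwa [h.law_Z i])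

lemma abs_Y_le (h : IsNoisySample P ν f q Z Y) (i : Fin N) : ∀ᵐ ω ∂P, |Y i ω| ≤ 1 := by
  filter_upwards [h.mem_Icc i] with ω hω
  exact abs_le.2 ⟨by linarith [hω.1], hω.2⟩

variable [IsProbabilityMeasure P]

/-- The expectation of an observation weighted by a function of its perturbation. -/
lemma integral_mul (h : IsNoisySample P ν f q Z Y) (hq : Measurable q) {q' : Vec d → Vec d}
    (hq' : Measurable q') (hleft : Function.LeftInverse q' q)
    (hfq : AEStronglyMeasurable (fun w => f (q w)) ν) {φ : Vec d → ℝ} (hφ : Measurable φ) {C : ℝ}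
    (hC : ∀ᵐ w ∂ν, |φ w| ≤ C) (i : Fin N) :
    ∫ ω, φ (Z i ω) * Y i ω ∂P = ∫ w, φ w * f (q w) ∂ν := by
  have hZ := h.measurable_Z i
  have hY := h.measurable_Y i
  have hle : MeasurableSpace.comap (fun ω => q (Z i ω)) inferInstance ≤ mΩ := (hq.comp hZ).comap_le
  -- The conditioning is on q(Z), not on Z; the measurable left inverse of q recovers Z, so φ(Z) can
  -- be pulled out of the conditional expectation.
  have hφm : StronglyMeasurable[MeasurableSpace.comap (fun ω => q (Z i ω)) inferInstance]
      fun ω => φ (Z i ω) := by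
    have hcomp : (fun ω => φ (Z i ω)) = (fun x => φ (q' x)) ∘ fun ω => q (Z i ω) := by
      funext ω
      simp [hleft (Z i ω)]
    rw [hcomp]
    exact ((hφ.comp hq').comp (comap_measurable _)).stronglyMeasurable
  have hYint : Integrable (Y i) P := Integrable.of_bound hY.aestronglyMeasurable 1 (h.abs_Y_le i)
  have hint : Integrable (fun ω => φ (Z i ω) * Y i ω) P :=
    hYint.bdd_mul (hφ.comp hZ).aestronglyMeasurable (h.ae_Z hC i)
  calc ∫ ω, φ (Z i ω) * Y i ω ∂P =
      ∫ ω, (P[fun ω => φ (Z i ω) * Y i ω |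
        MeasurableSpace.comap (fun ω => q (Z i ω)) inferInstance]) ω ∂P :=
        (integral_condExp hle).symm
    _ = ∫ ω, φ (Z i ω) * f (q (Z i ω)) ∂P := by
        refine integral_congr_ae ?_
        filter_upwards [condExp_mul_of_stronglyMeasurable_left hφm hint hYint,
          h.condExp_eq i] with ω h1 h2
        exact h1.trans (congrArg (φ (Z i ω) * ·) h2)
    _ = ∫ w, φ w * f (q w) ∂ν := by
        rw [← h.law_Z i, integral_map hZ.aemeasurable]
        rw [h.law_Z i]
        exact hφ.aestronglyMeasurable.mul hfq

lemma integral_Y (h : IsNoisySample P ν f q Z Y) (hq : Measurable q) {q' : Vec d → Vec d}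
    (hq' : Measurable q') (hleft : Function.LeftInverse q' q)
    (hfq : AEStronglyMeasurable (fun w => f (q w)) ν) (i : Fin N) :
    ∫ ω, Y i ω ∂P = ∫ w, f (q w) ∂ν := by
  simpa using h.integral_mul hq hq' hleft hfq (φ := fun _ => 1) measurable_const (C := 1) (by simp) i

/-- Concentration of the estimator of the value. -/
lemma measureReal_valueEst_le (h : IsNoisySample P ν f q Z Y) (hN : 1 ≤ N) (hq : Measurable q)
    {q' : Vec d → Vec d} (hq' : Measurable q') (hleft : Function.LeftInverse q' q)
    (hfq : AEStronglyMeasurable (fun w => f (q w)) ν) {L : ℝ} (hL : 0 < L) :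
    P.real {ω | ¬ |valueEst (fun i => Y i ω) - ∫ w, f (q w) ∂ν| ≤ 4 * √L / √(N : ℝ)}
      ≤ 2 * Real.exp (-(3 * L)) := by
  have hN0 : (0 : ℝ) < N := by positivity
  set m : ℝ := ∫ w, f (q w) ∂ν with hm
  have hmean : ∀ i, ∫ ω, Y i ω ∂P = m := h.integral_Y hq hq' hleft hfq
  have hsqrt : 4 * √((N : ℝ) * 1 * L) = N * (4 * √L / √(N : ℝ)) := by
    have h1 : √(N : ℝ) ≠ 0 := by positivity
    have h2 : (N : ℝ) = √(N : ℝ) * √(N : ℝ) := (Real.mul_self_sqrt hN0.le).symm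
    rw [mul_one, Real.sqrt_mul hN0.le]
    field_simp
    rw [Real.sq_sqrt hN0.le]
  have hval : ∀ ω, |valueEst (fun i => Y i ω) - m| = |∑ i, Y i ω - N * m| / N := by
    intro ω
    rw [valueEst, ← abs_of_pos hN0, ← abs_div, abs_of_pos hN0]
    congr 1
    field_simp
  -- Bernstein needs L ≤ N. Otherwise the tolerance 4√L/√N exceeds 1, while the estimate and its
  -- mean both lie in [0,1].
  rcases le_or_gt L N with hLN | hLN
  · refine (measureReal_mono (fun ω hω => ?_)).trans
      (measureReal_abs_sum_sub_ge_le h.measurable_Y h.abs_Y_le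
        (h.indep.comp (fun _ p => p.2) fun _ => measurable_snd) hmean (s := 1) (fun i => ?_) hL
        (by simpa using hLN))
    · simp only [mem_ofPred_eq, not_le, hval, lt_div_iff₀ hN0] at hω ⊢
      rw [hsqrt, mul_comm]
      exact hω.le
    · refine (integral_mono_of_nonneg (ae_of_all _ fun ω => sq_nonneg _)
        (integrable_const (1 : ℝ)) ?_).trans (by simp)
      filter_upwards [h.abs_Y_le i] with ω hω
      exact (sq_le_one_iff_abs_le_one _).2 hω
  · have hall : ∀ᵐ ω ∂P, |valueEst (fun i => Y i ω) - m| ≤ 4 * √L / √(N : ℝ) := by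
      have i₀ : Fin N := ⟨0, hN⟩
      have hm0 : 0 ≤ m := by
        rw [← hmean i₀]
        exact integral_nonneg_of_ae ((h.mem_Icc i₀).mono fun ω hω => hω.1)
      have hm1 : m ≤ 1 := by
        rw [← hmean i₀]
        exact (integral_mono_of_nonneg ((h.mem_Icc i₀).mono fun ω hω => hω.1)
          (integrable_const (1 : ℝ)) ((h.mem_Icc i₀).mono fun ω hω => hω.2)).trans (by simp)
      filter_upwards [ae_all_iff.2 h.mem_Icc] with ω hω
      have h0 : 0 ≤ ∑ i, Y i ω := Finset.sum_nonneg fun i _ => (hω i).1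
      have h1 : ∑ i, Y i ω ≤ N := by
        simpa using Finset.sum_le_sum (s := Finset.univ) fun i _ => (hω i).2
      have h2 : |∑ i, Y i ω - N * m| ≤ N := by
        rw [abs_le]
        constructor <;> nlinarith
      have h3 : √(N : ℝ) ≤ √L := Real.sqrt_le_sqrt hLN.le
      have h4 : 0 < √(N : ℝ) := by positivity
      rw [hval]
      calc |∑ i, Y i ω - N * m| / N ≤ 1 := (div_le_one hN0).2 h2
        _ ≤ 4 * √L / √(N : ℝ) := by
            rw [one_le_div h4]
            linarith
    rw [measureReal_def, ae_iff.1 hall, ENNReal.toReal_zero]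
    positivity

/-- Concentration of the estimator of the gradient, tested against a vector. -/
lemma measureReal_gradEst_le {c : ℝ} (h : IsNoisySample P (sphereUnif d c) f q Z Y) (hd : 1 ≤ d)
    (hc : 0 < c) (hN : 1 ≤ N) (hq : Measurable q) {q' : Vec d → Vec d} (hq' : Measurable q')
    (hleft : Function.LeftInverse q' q)
    (hfq : AEStronglyMeasurable (fun w => f (q w)) (sphereUnif d c))
    (hfb : ∀ᵐ w ∂(sphereUnif d c), |f (q w)| ≤ 1) (u : Vec d) {L : ℝ} (hL : 0 < L)
    (hLN : d * L ≤ N) :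
    P.real {ω | ¬ |⟪gradEst c (fun i => Z i ω) (fun i => Y i ω)
        - ((d : ℝ) / c ^ 2) • ∫ w, f (q w) • w ∂(sphereUnif d c), u⟫|
          ≤ 4 * √L * ‖u‖ * (√(d : ℝ) / (c * √(N : ℝ)))}
      ≤ 2 * Real.exp (-(3 * L)) := by
  have hprob := isProbabilityMeasure_sphereUnif hd c
  have hN0 : (0 : ℝ) < N := by positivity
  have hd0 : (0 : ℝ) < d := by positivity
  rcases eq_or_ne u 0 with rfl | hu
  · simp only [inner_zero_right, abs_zero, norm_zero, mul_zero, zero_mul, le_refl, not_true_eq_false,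
      ofPred_false, measureReal_empty]
    positivity
  have hu0 : 0 < ‖u‖ := norm_pos_iff.2 hu
  -- Normalised so that |φ| ≤ 1 on the sphere, with second moment 1/d; Bernstein with s = 1/d then
  -- asks exactly for dL ≤ N.
  let φ : Vec d → ℝ := fun w => ⟪w, u⟫ / (c * ‖u‖)
  have hφ : Measurable φ := by fun_prop
  have hφ1 : ∀ᵐ w ∂(sphereUnif d c), |φ w| ≤ 1 := by
    filter_upwards [ae_norm_sphereUnif hc.le] with w hw
    rw [abs_div, abs_of_pos (by positivity : 0 < c * ‖u‖), div_le_one (by positivity), ← hw]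
    exact abs_real_inner_le_norm w u
  have hφ2 : ∫ w, φ w ^ 2 ∂(sphereUnif d c) = 1 / d := by
    simp only [φ, div_pow, integral_div, integral_sphereUnif_inner_sq hd hc]
    field_simp
  set m : ℝ := ∫ w, φ w * f (q w) ∂(sphereUnif d c) with hm
  have hvint : Integrable (fun w => f (q w) • w) (sphereUnif d c) := by
    refine Integrable.of_bound (hfq.smul aestronglyMeasurable_id) c ?_
    filter_upwards [hfb, ae_norm_sphereUnif hc.le] with w h1 h2
    rw [norm_smul, h2]
    exact mul_le_of_le_one_left hc.le h1
  have hmean : ⟪((d : ℝ) / c ^ 2) • ∫ w, f (q w) • w ∂(sphereUnif d c), u⟫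
      = d * ‖u‖ / (c * N) * (N * m) := by
    rw [real_inner_smul_left, real_inner_comm, ← integral_inner hvint]
    have : ∀ w : Vec d, ⟪u, f (q w) • w⟫ = c * ‖u‖ * (φ w * f (q w)) := fun w => by
      rw [real_inner_smul_right, real_inner_comm]
      simp only [φ]
      field_simp
    simp only [this, integral_const_mul, ← hm]
    field_simp
  have hest : ∀ ω, ⟪gradEst c (fun i => Z i ω) (fun i => Y i ω), u⟫
      = d * ‖u‖ / (c * N) * ∑ i, φ (Z i ω) * Y i ω := by
    intro ω
    rw [gradEst, real_inner_smul_left, sum_inner, Finset.mul_sum, Finset.mul_sum]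
    refine Finset.sum_congr rfl fun i _ => ?_
    rw [real_inner_smul_left]
    simp only [φ]
    field_simp
  have hthr : 4 * √L * ‖u‖ * (√(d : ℝ) / (c * √(N : ℝ)))
      = d * ‖u‖ / (c * N) * (4 * √(N * (1 / d) * L)) := by
    rw [Real.sqrt_mul (by positivity), Real.sqrt_mul (by positivity), Real.sqrt_div zero_le_one,
      Real.sqrt_one]
    have h1 : √(N : ℝ) ^ 2 = N := Real.sq_sqrt hN0.le
    have h2 : √(d : ℝ) ^ 2 = d := Real.sq_sqrt hd0.le
    have h3 : √(N : ℝ) ≠ 0 := by positivity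
    have h4 : √(d : ℝ) ≠ 0 := by positivity
    field_simp
    rw [h1, h2]
    ring
  refine (measureReal_mono (fun ω hω => ?_)).trans
    (measureReal_abs_sum_sub_ge_le (W := fun i ω => φ (Z i ω) * Y i ω) (m := m) (s := 1 / d)
      (fun i => (hφ.comp (h.measurable_Z i)).mul (h.measurable_Y i)) (fun i => ?_)
      (h.indep.comp (fun _ p => φ p.1 * p.2) fun _ => by fun_prop)
      (h.integral_mul hq hq' hleft hfq hφ hφ1) (fun i => ?_) hL ?_)
  · have hpos : 0 < d * ‖u‖ / (c * N) := by positivity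
    simp only [mem_ofPred_eq, not_le, inner_sub_left, hest, hmean, hthr, ← mul_sub, abs_mul,
      abs_of_pos hpos] at hω ⊢
    exact (lt_of_mul_lt_mul_left hω hpos.le).le
  · filter_upwards [h.ae_Z hφ1 i, h.abs_Y_le i] with ω h1 h2
    rw [abs_mul]
    exact mul_le_one₀ h1 (abs_nonneg _) h2
  · rw [← hφ2, ← h.law_Z i, integral_map (h.measurable_Z i).aemeasurable (by fun_prop)]
    refine integral_mono_of_nonneg (ae_of_all _ fun ω => sq_nonneg _) ?_ ?_
    · refine Integrable.of_bound
        ((hφ.comp (h.measurable_Z i)).pow_const 2).aestronglyMeasurable 1 ?_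
      filter_upwards [h.ae_Z hφ1 i] with ω h1
      rw [norm_pow]
      exact pow_le_one₀ (norm_nonneg _) h1
    · filter_upwards [h.abs_Y_le i] with ω h2
      simp only [mul_pow]
      exact mul_le_of_le_one_right (sq_nonneg _) ((sq_le_one_iff_abs_le_one _).2 h2)
  · rw [mul_one_div, le_div_iff₀ hd0, mul_comm]
    exact hLN

end IsNoisySample

end Sampling

end ZerothOrder

/-! ### The main theorem. -/

theorem mainTheorem4
    {d : ℕ} (hd : 1 ≤ d)
    -- the domain and the objective; the values of `f` outside `Xbar` play no role
    (Xbar : Set (ZerothOrder.Vec d)) (hXbar_conv : Convex ℝ Xbar)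
    (hXbar_bdd : Bornology.IsBounded Xbar)
    (f : ZerothOrder.Vec d → ℝ) (hf_conv : ConvexOn ℝ Xbar f)
    (hf_mem : ∀ x ∈ Xbar, f x ∈ Icc (0 : ℝ) 1)
    (hf_meas : Measurable (Xbar.domRestrict f))
    -- the current convex set, which determines the normalisation
    (X : Set (ZerothOrder.Vec d)) (hX_conv : Convex ℝ X) (hX_sub : X ⊆ Xbar)
    (hX_vol : volume X ≠ 0)
    (c : ℝ) (hc : 0 ≤ c) (z : ZerothOrder.Vec d)
    (hz : closedBall z c ⊆ ZerothOrder.normMap X '' Xbar)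
    (u : ZerothOrder.Vec d) (δ : ℝ) (hδ : 0 < δ) {N : ℕ} (hN : 1 ≤ N)
    {Ω : Type*} [MeasurableSpace Ω] (P : Measure Ω) [IsProbabilityMeasure P]
    -- ball samples and sphere samples, with the observations of `f` there
    (Zb : Fin N → Ω → ZerothOrder.Vec d) (Yb : Fin N → Ω → ℝ)
    (hb : ZerothOrder.IsNoisySample P (ZerothOrder.ballUnif d c) f
      (fun w => ZerothOrder.normInv X (z + w)) Zb Yb)
    (Zs : Fin N → Ω → ZerothOrder.Vec d) (Ys : Fin N → Ω → ℝ)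
    (hs : ZerothOrder.IsNoisySample P (ZerothOrder.sphereUnif d c) f
      (fun w => ZerothOrder.normInv X (z + w)) Zs Ys) :
    (0 < c → closedBall z c ⊆ interior (ZerothOrder.normMap X '' Xbar) →
      DifferentiableAt ℝ (ZerothOrder.smooth (ZerothOrder.gFun f X) c) z) ∧
    1 - δ ≤ P.real {ω |
      |ZerothOrder.valueEst (fun i => Yb i ω)
          - ZerothOrder.smooth (ZerothOrder.gFun f X) c z|
        ≤ ZerothOrder.etaConc (1 / δ) / √(N : ℝ) ∧
      (0 < c → (d : ℝ) * Real.log (2 / δ) ≤ (N : ℝ) →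
        -- the gradient of `g_c` at `z`, whenever it exists
        (closedBall z c ⊆ interior (ZerothOrder.normMap X '' Xbar) →
          |⟪ZerothOrder.gradEst c (fun i => Zs i ω) (fun i => Ys i ω)
              - ∇ (ZerothOrder.smooth (ZerothOrder.gFun f X) c) z, u⟫|
            ≤ ZerothOrder.etaConc (1 / δ) * ‖u‖ * (√(d : ℝ) / (c * √(N : ℝ)))) ∧
        -- the spherical mean that stands for the gradient when the ball touches the boundary
        |⟪ZerothOrder.gradEst c (fun i => Zs i ω) (fun i => Ys i ω)
            - ZerothOrder.sphereMean (ZerothOrder.gFun f X) c z, u⟫|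
          ≤ ZerothOrder.etaConc (1 / δ) * ‖u‖ * (√(d : ℝ) / (c * √(N : ℝ))))} := by
  have hdet : IsUnit (ZerothOrder.sqrtCov X).det :=
    ZerothOrder.isUnit_det_sqrtCov hX_vol (hXbar_bdd.subset hX_sub) hX_conv
  rw [ZerothOrder.normMap_image_eq_preimage hd hdet] at hz ⊢
  have hgrad : 0 < c → closedBall z c ⊆ interior (ZerothOrder.normInv X ⁻¹' Xbar) →
      HasGradientAt (ZerothOrder.smooth (ZerothOrder.gFun f X) c)
        (ZerothOrder.sphereMean (ZerothOrder.gFun f X) c z) z := fun hc0 hint =>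
    ZerothOrder.hasGradientAt_smooth hd isOpen_interior
      (ZerothOrder.convexOn_gFun hf_conv).continuousOn_interior hc0 hint
  refine ⟨fun hc0 hint => (hgrad hc0 hint).differentiableAt, ?_⟩
  -- For δ ≥ 1 the probability bound is void, whatever the sign of the logarithm; below 1 the
  -- logarithm is positive.
  rcases le_or_gt 1 δ with hδ1 | hδ1
  · exact (sub_nonpos.2 hδ1).trans measureReal_nonneg
  set L : ℝ := Real.log (2 / δ) with hLdef
  have hL : 0 < L := Real.log_pos ((one_lt_div hδ).2 (by linarith))
  have heta : ZerothOrder.etaConc (1 / δ) = 4 * √L := by rw [ZerothOrder.etaConc, mul_one_div]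
  have hq : Measurable fun w : ZerothOrder.Vec d => ZerothOrder.normInv X (z + w) :=
    (ZerothOrder.continuous_normInv.comp (continuous_const.add continuous_id)).measurable
  have hq' : Measurable fun x : ZerothOrder.Vec d => ZerothOrder.normMap X x - z :=
    (ZerothOrder.continuous_normMap.sub continuous_const).measurable
  have hleft : Function.LeftInverse (fun x : ZerothOrder.Vec d => ZerothOrder.normMap X x - z)
      fun w => ZerothOrder.normInv X (z + w) := fun w => by
    simp [ZerothOrder.normMap_normInv hd hdet]
  have hmaps : MapsTo (fun w : ZerothOrder.Vec d => ZerothOrder.normInv X (z + w))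
      (closedBall 0 c) Xbar := fun w hw =>
    hz (by simpa [mem_closedBall, dist_eq_norm] using hw)
  have hball : ∀ᵐ w ∂(ZerothOrder.ballUnif d c), w ∈ closedBall (0 : ZerothOrder.Vec d) c :=
    (ZerothOrder.ae_norm_le_ballUnif hc).mono fun w hw => mem_closedBall_zero_iff.2 hw
  have hsphere : ∀ᵐ w ∂(ZerothOrder.sphereUnif d c), w ∈ closedBall (0 : ZerothOrder.Vec d) c :=
    (ZerothOrder.ae_norm_sphereUnif hc).mono fun w hw => mem_closedBall_zero_iff.2 hw.le
  have hvalue := hb.measureReal_valueEst_le hN hq hq' hleft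
    (ZerothOrder.aestronglyMeasurable_comp_of_ae_mem hf_meas hq measurableSet_closedBall hmaps
      hball) hL
  have hgradient : 0 < c → d * L ≤ N → _ := fun hc0 hLN =>
    hs.measureReal_gradEst_le hd hc0 hN hq hq' hleft
      (ZerothOrder.aestronglyMeasurable_comp_of_ae_mem hf_meas hq measurableSet_closedBall hmaps
        hsphere)
      (hsphere.mono fun w hw => abs_le.2
        ⟨by linarith [(hf_mem _ (hmaps hw)).1], (hf_mem _ (hmaps hw)).2⟩) u hL hLN
  set bad₁ : Set Ω := {ω | ¬ |ZerothOrder.valueEst (fun i => Yb i ω)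
    - ZerothOrder.smooth (ZerothOrder.gFun f X) c z| ≤ 4 * √L / √(N : ℝ)}
  -- The side conditions sit inside the event, which is empty when they fail, so one union bound
  -- covers all cases.
  set bad₂ : Set Ω := {ω | (0 < c ∧ d * L ≤ N) ∧
    ¬ |⟪ZerothOrder.gradEst c (fun i => Zs i ω) (fun i => Ys i ω)
      - ZerothOrder.sphereMean (ZerothOrder.gFun f X) c z, u⟫|
      ≤ 4 * √L * ‖u‖ * (√(d : ℝ) / (c * √(N : ℝ)))} with hbad₂
  have h₂ : P.real bad₂ ≤ 2 * Real.exp (-(3 * L)) := by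
    by_cases hcL : 0 < c ∧ d * L ≤ N
    · exact (measureReal_mono fun ω hω => hω.2).trans (hgradient hcL.1 hcL.2)
    · simp only [hbad₂, hcL, false_and, ofPred_false, measureReal_empty]
      positivity
  have hexp : Real.exp (-(3 * L)) = (δ / 2) ^ 3 := by
    rw [show -(3 * L) = (3 : ℕ) * -L by push_cast; ring, Real.exp_nat_mul, hLdef, ← Real.log_inv,
      inv_div, Real.exp_log (by positivity)]
  -- The bad events cost at most 4(δ/2)³ = δ³/2 ≤ δ. Only subadditivity is used, so S need not be
  -- measurable.
  have hcover : ∀ S : Set Ω, (∀ ω, ω ∉ bad₁ → ω ∉ bad₂ → ω ∈ S) → 1 - δ ≤ P.real S := by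
    intro S hS
    have h1 : P.real univ ≤ P.real (S ∪ (bad₁ ∪ bad₂)) := measureReal_mono fun ω _ => by
      by_cases hω₁ : ω ∈ bad₁
      · exact Or.inr (Or.inl hω₁)
      by_cases hω₂ : ω ∈ bad₂
      · exact Or.inr (Or.inr hω₂)
      exact Or.inl (hS ω hω₁ hω₂)
    rw [probReal_univ] at h1
    have h2 := measureReal_union_le (μ := P) S (bad₁ ∪ bad₂)
    have h3 := measureReal_union_le (μ := P) bad₁ bad₂
    have h4 : P.real bad₁ ≤ 2 * Real.exp (-(3 * L)) := hvalue
    rw [hexp] at h₂ h4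
    have h5 : δ ^ 3 ≤ δ := pow_le_of_le_one hδ.le hδ1.le three_ne_zero
    have h6 : (δ / 2) ^ 3 = δ ^ 3 / 8 := by ring
    linarith
  refine hcover _ fun ω hω₁ hω₂ => ?_
  rw [heta]
  have hω₂' : 0 < c → d * L ≤ N →
      |⟪ZerothOrder.gradEst c (fun i => Zs i ω) (fun i => Ys i ω)
      - ZerothOrder.sphereMean (ZerothOrder.gFun f X) c z, u⟫|
        ≤ 4 * √L * ‖u‖ * (√(d : ℝ) / (c * √(N : ℝ))) := fun h1 h2 =>
    not_not.1 fun h3 => hω₂ ⟨⟨h1, h2⟩, h3⟩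
  refine ⟨not_not.1 hω₁, fun hc0 hLN => ⟨fun hint => ?_, hω₂' hc0 hLN⟩⟩
  rw [(hgrad hc0 hint).gradient]
  exact hω₂' hc0 hLN
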